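/- **Definitions.** Groups are discrete. A group $G$ is *binate* if it is nontrivial and for every finitely generated subgroup $H\le G$ there are a homomorphism $\varphi: H\to G$ and an element $u\in G$ such that $h=[u,\varphi(h)]=u\,\varphi(h)\,u^{-1}\varphi(h)^{-1}$ for all $h\in H$. For a group $G$, let $C_r^*(G)$ be its reduced $C^*$-algebra (the norm closure of the $*$-algebra of operators on $\ell^2(G)$ generated by the left translations) and $\mathcal N(G)$ its group von Neumann algebra (the double commutant of the left translations on $\ell^2(G)$), with standard trace $\mathrm{tr}_{\mathcal N(G)}(T)=\langle T\delta_1,\delta_1\rangle$. This trace induces a homomorphism $K_0(\mathcal N(G))\to\mathbb C$, which sends the class of an idempotent matrix $(e_{ij})$ to $\sum_i \mathrm{tr}_{\mathcal N(G)}(e_{ii})$. The *Kaplansky trace* is the composition $$\kappa: K_0(C_r^*(G))\to K_0(\mathcal N(G))\xrightarrow{\ \mathrm{tr}_{\mathcal N(G)}\ }\mathbb C$$ whose first map is induced by the inclusion. Let $\Lambda_G\subset\mathbb Q$ be the ring of all rational numbers $a/d$ with $a\in\mathbb Z$ and $d$ a (possibly empty) product of orders of finite subgroups of $G$. * The *modified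 trace conjecture of Baum–Connes* holds for $G$ if the image of $\kappa$ is contained in $\Lambda_G$. * The *Farkas conjecture* holds for $G$ if, for every rational number $q$ in the image of the composition $K_0(\mathbb CG)\to K_0(C_r^*(G))\xrightarrow{\ \kappa\ }\mathbb C$ and every prime $p$ dividing the denominator of $q$ in lowest terms, $G$ has an element of order $p$. **Corollary 4.5.** (a) The modified trace conjecture of Baum–Connes holds for all groups if and only if it holds for all binate groups. (b) The Farkas conjecture holds for all groups if and only if it holds for all binate groups. -/

import Mathlib

/-- A binate group: a nontrivial group `G` such that every finitely generated subgroup `H` admits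
a structure map `φ : H → G` (a homomorphism) and a structure element `u ∈ G` with
`h = [u, φ h]` for all `h ∈ H`. -/
def IsBinate (G : Type*) [Group G] : Prop :=
  Nontrivial G ∧ ∀ H : Subgroup G, H.FG → ∃ (φ : H →* G) (u : G), ∀ h : H,
    (h : G) = u * φ h * u⁻¹ * (φ h)⁻¹

/-! ### The group `K₀` of a unital ring, by idempotent matrices -/

namespace KZero

section Rel

variable {R : Type*} [Ring R] {l m n m' n' : Type*} [Fintype l] [Fintype m] [Fintype n]
  [Fintype m'] [Fintype n']

/-- Square matrices `e`, `f`, possibly of different sizes, are equivalent if `e = x * y` and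
`f = y * x` for some rectangular matrices `x`, `y`. For idempotents this says that the finitely
generated projective modules that are their images are isomorphic. -/
def Rel (e : Matrix m m R) (f : Matrix n n R) : Prop :=
  ∃ (x : Matrix m n R) (y : Matrix n m R), x * y = e ∧ y * x = f

theorem Rel.refl {e : Matrix m m R} (he : e * e = e) : Rel e e := ⟨e, e, he, he⟩

theorem Rel.symm {e : Matrix m m R} {f : Matrix n n R} (h : Rel e f) : Rel f e := by
  obtain ⟨x, y, h1, h2⟩ := h
  exact ⟨y, x, h2, h1⟩

theorem Rel.trans {e : Matrix l l R} {f : Matrix m m R} {g : Matrix n n R}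
    (he : e * e = e) (hg : g * g = g) (h : Rel e f) (h' : Rel f g) : Rel e g := by
  obtain ⟨x, y, h1, h2⟩ := h
  obtain ⟨z, w, h3, h4⟩ := h'
  refine ⟨x * z, w * y, ?_, ?_⟩
  · calc x * z * (w * y) = x * (z * w) * y := by simp only [Matrix.mul_assoc]
      _ = (x * y) * (x * y) := by rw [h3, ← h2]; simp only [Matrix.mul_assoc]
      _ = e := by rw [h1, he]
  · calc w * y * (x * z) = w * (y * x) * z := by simp only [Matrix.mul_assoc]
      _ = (w * z) * (w * z) := by rw [h2, ← h3]; simp only [Matrix.mul_assoc]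
      _ = g := by rw [h4, hg]

theorem Rel.submatrix {e : Matrix m m R} (he : e * e = e) (σ : n ≃ m) :
    Rel (e.submatrix σ σ) e := by
  refine ⟨e.submatrix σ id, e.submatrix id σ, ?_, ?_⟩
  · have := Matrix.submatrix_mul e e σ id σ Function.bijective_id
    rw [← this, he]
  · rw [Matrix.submatrix_mul_equiv, he, Matrix.submatrix_id_id]

theorem Rel.fromBlocks {e : Matrix m m R} {e' : Matrix m' m' R} {f : Matrix n n R}
    {f' : Matrix n' n' R} (h : Rel e e') (h' : Rel f f') :
    Rel (Matrix.fromBlocks e 0 0 f) (Matrix.fromBlocks e' 0 0 f') := by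
  obtain ⟨x, y, h1, h2⟩ := h
  obtain ⟨z, w, h3, h4⟩ := h'
  exact ⟨Matrix.fromBlocks x 0 0 z, Matrix.fromBlocks y 0 0 w,
    by simp [Matrix.fromBlocks_multiply, h1, h3], by simp [Matrix.fromBlocks_multiply, h2, h4]⟩

end Rel

/-- Idempotent square matrices over `R`, of all finite sizes. -/
structure Idem (R : Type*) [Ring R] where
  /-- The size. -/
  size : ℕ
  /-- The matrix. -/
  mat : Matrix (Fin size) (Fin size) R
  idem : mat * mat = mat

variable (R : Type*) [Ring R]

instance idemSetoid : Setoid (Idem R) where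
  r e f := Rel e.mat f.mat
  iseqv := ⟨fun e => Rel.refl e.idem, fun h => h.symm,
    fun {e _ g} h h' => Rel.trans e.idem g.idem h h'⟩

/-- The set of equivalence classes of idempotent matrices over `R`, that is, of isomorphism classes
of finitely generated projective `R`-modules. -/
def ProjClass : Type _ := Quotient (idemSetoid R)

variable {R}

/-- The class of an idempotent matrix. -/
def ProjClass.mk (e : Idem R) : ProjClass R := Quotient.mk _ e

/-- The block sum of two idempotent matrices. -/
def Idem.sum (e f : Idem R) : Idem R where
  size := e.size + f.size
  mat := (Matrix.fromBlocks e.mat 0 0 f.mat).submatrix finSumFinEquiv.symm finSumFinEquiv.symm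
  idem := by
    rw [Matrix.submatrix_mul_equiv, Matrix.fromBlocks_multiply]
    simp [e.idem, f.idem]

/-- The idempotent matrix of size zero. -/
def Idem.zero : Idem R := ⟨0, 0, by simp⟩

theorem Idem.fromBlocks_idem {m n : Type*} [Fintype m] [Fintype n] {e : Matrix m m R}
    {f : Matrix n n R} (he : e * e = e) (hf : f * f = f) :
    Matrix.fromBlocks e 0 0 f * Matrix.fromBlocks e 0 0 f = Matrix.fromBlocks e 0 0 f := by
  simp [Matrix.fromBlocks_multiply, he, hf]

theorem Idem.sum_rel (e f : Idem R) :
    Rel (e.sum f).mat (Matrix.fromBlocks e.mat 0 0 f.mat) :=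
  Rel.submatrix (Idem.fromBlocks_idem e.idem f.idem) _

theorem rel_of_submatrix {m n : Type*} [Fintype m] [Fintype n] {e : Matrix m m R}
    {f : Matrix n n R} (hf : f * f = f) (σ : m ≃ n) (h : f.submatrix σ σ = e) : Rel e f :=
  h ▸ Rel.submatrix hf σ

instance : Zero (ProjClass R) := ⟨ProjClass.mk Idem.zero⟩

instance : Add (ProjClass R) :=
  ⟨Quotient.map₂ Idem.sum fun e e' h f f' h' =>
    Rel.trans (e.sum f).idem (e'.sum f').idem (Idem.sum_rel e f)
      (Rel.trans (Idem.fromBlocks_idem e.idem f.idem) (e'.sum f').idem (Rel.fromBlocks h h')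
        (Idem.sum_rel e' f').symm)⟩

theorem ProjClass.mk_add (e f : Idem R) : mk e + mk f = mk (e.sum f) := rfl

theorem ProjClass.mk_zero : mk (Idem.zero : Idem R) = 0 := rfl

theorem ProjClass.sound {e f : Idem R} (h : Rel e.mat f.mat) : mk e = mk f := Quotient.sound h

theorem ProjClass.add_comm' (a b : ProjClass R) : a + b = b + a := by
  induction a using Quotient.inductionOn with | _ e
  induction b using Quotient.inductionOn with | _ f
  refine ProjClass.sound ?_
  refine Rel.trans (e.sum f).idem (f.sum e).idem (Idem.sum_rel e f)
    (Rel.trans (Idem.fromBlocks_idem e.idem f.idem) (f.sum e).idem ?_ (Idem.sum_rel f e).symm)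
  refine rel_of_submatrix (Idem.fromBlocks_idem f.idem e.idem) (Equiv.sumComm _ _) ?_
  ext (i | i) (j | j) <;> simp

theorem ProjClass.zero_add' (a : ProjClass R) : 0 + a = a := by
  induction a using Quotient.inductionOn with | _ e
  refine ProjClass.sound ?_
  refine Rel.trans (Idem.zero.sum e).idem e.idem (Idem.sum_rel Idem.zero e) ?_
  have : IsEmpty (Fin (Idem.zero : Idem R).size) := inferInstanceAs (IsEmpty (Fin 0))
  refine rel_of_submatrix e.idem (Equiv.emptySum _ _) ?_
  ext (i | i) (j | j)
  · exact isEmptyElim i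
  · exact isEmptyElim i
  · exact isEmptyElim j
  · simp

theorem ProjClass.add_assoc' (a b c : ProjClass R) : a + b + c = a + (b + c) := by
  induction a using Quotient.inductionOn with | _ e
  induction b using Quotient.inductionOn with | _ f
  induction c using Quotient.inductionOn with | _ g
  refine ProjClass.sound ?_
  have hL : Rel ((e.sum f).sum g).mat
      (Matrix.fromBlocks (Matrix.fromBlocks e.mat 0 0 f.mat) 0 0 g.mat) :=
    Rel.trans ((e.sum f).sum g).idem
      (Idem.fromBlocks_idem (Idem.fromBlocks_idem e.idem f.idem) g.idem)
      (Idem.sum_rel (e.sum f) g) (Rel.fromBlocks (Idem.sum_rel e f) (Rel.refl g.idem))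
  have hR : Rel (e.sum (f.sum g)).mat
      (Matrix.fromBlocks e.mat 0 0 (Matrix.fromBlocks f.mat 0 0 g.mat)) :=
    Rel.trans (e.sum (f.sum g)).idem
      (Idem.fromBlocks_idem e.idem (Idem.fromBlocks_idem f.idem g.idem))
      (Idem.sum_rel e (f.sum g)) (Rel.fromBlocks (Rel.refl e.idem) (Idem.sum_rel f g))
  refine Rel.trans ((e.sum f).sum g).idem (e.sum (f.sum g)).idem hL
    (Rel.trans (Idem.fromBlocks_idem (Idem.fromBlocks_idem e.idem f.idem) g.idem)
      (e.sum (f.sum g)).idem ?_ hR.symm)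
  refine rel_of_submatrix
    (Idem.fromBlocks_idem e.idem (Idem.fromBlocks_idem f.idem g.idem)) (Equiv.sumAssoc _ _ _) ?_
  ext ((i | i) | i) ((j | j) | j) <;> simp

instance : AddCommMonoid (ProjClass R) where
  add_assoc := ProjClass.add_assoc'
  zero_add := ProjClass.zero_add'
  add_zero a := by rw [ProjClass.add_comm', ProjClass.zero_add']
  add_comm := ProjClass.add_comm'
  nsmul := nsmulRec

end KZero

/-- `K₀(R)`: the Grothendieck group of the monoid of isomorphism classes of finitely generated
projective modules over the unital ring `R`, given by idempotent matrices. -/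
abbrev KZero (R : Type*) [Ring R] : Type _ := Algebra.GrothendieckAddGroup (KZero.ProjClass R)

namespace KZero

variable {R S : Type*} [Ring R] [Ring S]

/-- The image of an idempotent matrix under a ring homomorphism. -/
def Idem.map (f : R →+* S) (e : Idem R) : Idem S where
  size := e.size
  mat := e.mat.map f
  idem := by rw [← Matrix.map_mul, e.idem]

/-- The map induced by a ring homomorphism on classes of idempotent matrices. -/
def ProjClass.map (f : R →+* S) : ProjClass R →+ ProjClass S where
  toFun := Quotient.map (Idem.map f) (by
    rintro e e' ⟨x, y, h1, h2⟩
    have h3 : x.map f * y.map f = e.mat.map f := by rw [← Matrix.map_mul, h1]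
    have h4 : y.map f * x.map f = e'.mat.map f := by rw [← Matrix.map_mul, h2]
    exact ⟨x.map f, y.map f, h3, h4⟩)
  map_zero' := by
    refine ProjClass.sound (?_ : Rel (Idem.map f Idem.zero).mat (Idem.zero : Idem S).mat)
    exact ⟨0, 0, Matrix.ext fun i => Fin.elim0 i, Matrix.ext fun i => Fin.elim0 i⟩
  map_add' := by
    intro a b
    induction a using Quotient.inductionOn with | _ e
    induction b using Quotient.inductionOn with | _ e'
    refine ProjClass.sound
      (?_ : Rel (Idem.map f (e.sum e')).mat ((Idem.map f e).sum (Idem.map f e')).mat)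
    have : (Idem.map f (e.sum e')).mat = ((Idem.map f e).sum (Idem.map f e')).mat := by
      simp only [Idem.map, Idem.sum, ← Matrix.submatrix_map, Matrix.fromBlocks_map]
      simp
    rw [this]
    exact Rel.refl ((Idem.map f e).sum (Idem.map f e')).idem

/-- Functoriality of `K₀`. -/
noncomputable def map (f : R →+* S) : KZero R →+ KZero S :=
  Algebra.GrothendieckAddGroup.lift
    ((Algebra.GrothendieckAddGroup.of (M := ProjClass S)).comp (ProjClass.map f))

/-- The map on classes of idempotent matrices induced by a trace, `[e] ↦ ∑ i, τ (e i i)`. -/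
def ProjClass.trace {B : Type*} [AddCommGroup B] (τ : R →+ B) (hτ : ∀ a b, τ (a * b) = τ (b * a)) :
    ProjClass R →+ B where
  toFun := Quotient.lift (fun e => ∑ i, τ (e.mat i i)) (by
    rintro e e' ⟨x, y, h1, h2⟩
    simp only [← h1, ← h2, Matrix.mul_apply, map_sum]
    rw [Finset.sum_comm]
    exact Finset.sum_congr rfl fun i _ => Finset.sum_congr rfl fun j _ => hτ _ _)
  map_zero' := by
    change ∑ i : Fin 0, _ = (0 : B)
    simp
  map_add' := by
    intro a b
    induction a using Quotient.inductionOn with | _ e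
    induction b using Quotient.inductionOn with | _ e'
    change ∑ i : Fin (e.size + e'.size), τ ((e.sum e').mat i i) =
      ∑ i, τ (e.mat i i) + ∑ i, τ (e'.mat i i)
    rw [Fin.sum_univ_add]
    simp [Idem.sum]

/-- The homomorphism `K₀(R) → B` induced by a trace `τ : R → B`, that is, by an additive map with
`τ (a * b) = τ (b * a)`. -/
noncomputable def trace {B : Type*} [AddCommGroup B] (τ : R →+ B)
    (hτ : ∀ a b, τ (a * b) = τ (b * a)) : KZero R →+ B :=
  Algebra.GrothendieckAddGroup.lift (ProjClass.trace τ hτ)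

end KZero

/-! ### The operator algebras of a discrete group -/

/-- The Hilbert space `ℓ²(G)`. -/
abbrev EllTwo (G : Type*) : Type _ := lp (fun _ : G => ℂ) 2

namespace GroupAlg

section Perm

variable {X : Type*}

/-- The isometry of `ℓ²(X)` induced by a permutation `σ` of `X`: `(U f) x = f (σ⁻¹ x)`. -/
noncomputable def permIsometry (σ : Equiv.Perm X) : EllTwo X →ₗᵢ[ℂ] EllTwo X where
  toFun f := ⟨fun x => f (σ.symm x), by
    have h := lp.memℓp f
    change Memℓp (fun x => f (σ.symm x)) 2
    rw [memℓp_gen_iff (by norm_num)] at h ⊢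
    exact (Equiv.summable_iff σ.symm).2 h⟩
  map_add' f g := rfl
  map_smul' c f := rfl
  norm_map' f := by
    simp only [lp.norm_eq_tsum_rpow (p := 2) (by norm_num)]
    congr 1
    exact Equiv.tsum_eq σ.symm (fun x => ‖f x‖ ^ (2 : ENNReal).toReal)

/-- The unitary representation of the permutations of `X` on `ℓ²(X)`. -/
noncomputable def permRep : Equiv.Perm X →* (EllTwo X →L[ℂ] EllTwo X) where
  toFun σ := (permIsometry σ).toContinuousLinearMap
  map_one' := rfl
  map_mul' _ _ := rfl

theorem permRep_apply (σ : Equiv.Perm X) (f : EllTwo X) (x : X) :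
    permRep σ f x = f (σ.symm x) := rfl

theorem star_permRep (σ : Equiv.Perm X) :
    star (permRep σ) = permRep σ⁻¹ := by
  rw [ContinuousLinearMap.star_eq_adjoint]
  symm
  rw [ContinuousLinearMap.eq_adjoint_iff]
  intro f g
  rw [lp.inner_eq_tsum, lp.inner_eq_tsum, ← Equiv.tsum_eq σ.symm]
  refine tsum_congr fun x => ?_
  have h : permRep σ⁻¹ f (σ.symm x) = f x := congrArg f (σ.apply_symm_apply x)
  rw [h]
  rfl

end Perm

variable (G : Type*) [Group G]

/-- The left regular representation of `G` on `ℓ²(G)`: `(λ_g f) x = f (g⁻¹ * x)`. -/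
noncomputable def leftReg : G →* (EllTwo G →L[ℂ] EllTwo G) :=
  permRep.comp (MulAction.toPermHom G G)

variable {G} in
theorem leftReg_apply (g : G) (f : EllTwo G) (x : G) : leftReg G g f x = f (g⁻¹ * x) := rfl

/-- The reduced C*-algebra of the discrete group `G`: the norm closure of the *-algebra of operators
on `ℓ²(G)` generated by left translations. -/
noncomputable def reducedCStar : StarSubalgebra ℂ (EllTwo G →L[ℂ] EllTwo G) :=
  (StarAlgebra.adjoin ℂ (Set.range (leftReg G))).topologicalClosure

/-- The group von Neumann algebra of `G`: the double commutant of the left translations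
on `ℓ²(G)`. -/
noncomputable def vonNeumann : VonNeumannAlgebra (EllTwo G) where
  toStarSubalgebra :=
    StarSubalgebra.centralizer ℂ
      (StarSubalgebra.centralizer ℂ (Set.range (leftReg G)) : Set (EllTwo G →L[ℂ] EllTwo G))
  centralizer_centralizer' := by
    change Set.centralizer (Set.centralizer
      (StarSubalgebra.centralizer ℂ (StarSubalgebra.centralizer ℂ (Set.range (leftReg G)) :
        Set (EllTwo G →L[ℂ] EllTwo G)) : Set (EllTwo G →L[ℂ] EllTwo G))) =
      (StarSubalgebra.centralizer ℂ (StarSubalgebra.centralizer ℂ (Set.range (leftReg G)) :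
        Set (EllTwo G →L[ℂ] EllTwo G)) : Set (EllTwo G →L[ℂ] EllTwo G))
    rw [StarSubalgebra.coe_centralizer_centralizer, Set.centralizer_centralizer_centralizer]

/-- The group von Neumann algebra, as a *-subalgebra of the bounded operators. -/
noncomputable abbrev vN : StarSubalgebra ℂ (EllTwo G →L[ℂ] EllTwo G) :=
  (vonNeumann G).toStarSubalgebra

theorem coe_vN : (vN G : Set (EllTwo G →L[ℂ] EllTwo G)) =
    (Set.range (leftReg G) ∪ star (Set.range (leftReg G))).centralizer.centralizer :=
  StarSubalgebra.coe_centralizer_centralizer ℂ (Set.range (leftReg G))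

theorem reducedCStar_le_vN : reducedCStar G ≤ vN G := by
  refine StarSubalgebra.topologicalClosure_minimal
    (StarAlgebra.adjoin_le_centralizer_centralizer ℂ (Set.range (leftReg G))) ?_
  change IsClosed (vN G : Set (EllTwo G →L[ℂ] EllTwo G))
  rw [coe_vN]
  exact Set.isClosed_centralizer _

theorem leftReg_mem (g : G) : leftReg G g ∈ reducedCStar G :=
  StarSubalgebra.le_topologicalClosure _ (StarAlgebra.subset_adjoin ℂ _ ⟨g, rfl⟩)

/-- The canonical homomorphism from the complex group ring to the reduced C*-algebra, which sends
a group element to the left translation by it. -/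
noncomputable def groupRingToCStar : MonoidAlgebra ℂ G →ₐ[ℂ] reducedCStar G :=
  MonoidAlgebra.lift ℂ (reducedCStar G) G ((leftReg G).codRestrict (reducedCStar G) (leftReg_mem G))

/-- The inclusion of the reduced C*-algebra in the group von Neumann algebra. -/
noncomputable def cstarToVN : reducedCStar G →⋆ₐ[ℂ] vN G :=
  StarSubalgebra.inclusion (reducedCStar_le_vN G)

open Classical in
/-- The basis vector of `ℓ²(G)` at `g`. -/
noncomputable def delta {G : Type*} (g : G) : EllTwo G := lp.single 2 g (1 : ℂ)

/-- The standard trace `T ↦ ⟨δ₁, T δ₁⟩` on the group von Neumann algebra (Mathlib's inner product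
is linear in the second variable). -/
noncomputable def vnTrace : vN G →+ ℂ where
  toFun T := inner ℂ (delta (1 : G)) ((T : EllTwo G →L[ℂ] EllTwo G) (delta 1))
  map_zero' := by simp
  map_add' S T := by simp

variable {G}

theorem inner_delta_left {G : Type*} (g : G) (f : EllTwo G) : inner ℂ (delta g) f = f g := by
  classical
  have := lp.inner_single_left (𝕜 := ℂ) (G := fun _ : G => ℂ) g (1 : ℂ) f
  simp only [delta]
  rw [this]
  simp

theorem comm_permRep_mulRight {T : EllTwo G →L[ℂ] EllTwo G} (hT : T ∈ vN G) (g : G) :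
    permRep (Equiv.mulRight g) * T = T * permRep (Equiv.mulRight g) := by
  have hT' : T ∈ (vN G : Set (EllTwo G →L[ℂ] EllTwo G)) := hT
  rw [coe_vN] at hT'
  refine hT' _ ?_
  have key : ∀ x : G, leftReg G x * permRep (Equiv.mulRight g) =
      permRep (Equiv.mulRight g) * leftReg G x := by
    intro x
    refine ContinuousLinearMap.ext fun f => lp.ext (funext fun y => ?_)
    change f (x⁻¹ * y * g⁻¹) = f (x⁻¹ * (y * g⁻¹))
    rw [mul_assoc]
  rintro S (⟨x, rfl⟩ | ⟨x, hx⟩)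
  · exact key x
  · have : S = leftReg G x⁻¹ := by
      rw [← star_star S, ← hx]
      change star (permRep _) = permRep (MulAction.toPermHom G G x⁻¹)
      rw [star_permRep, map_inv (MulAction.toPermHom G G)]
    rw [this]
    exact key _

theorem apply_delta {T : EllTwo G →L[ℂ] EllTwo G} (hT : T ∈ vN G) (g x : G) :
    T (delta g) x = T (delta 1) (x * g⁻¹) := by
  have hd : delta g = permRep (Equiv.mulRight g) (delta 1) := by
    classical
    refine lp.ext (funext fun y => ?_)
    change delta g y = delta 1 (y * g⁻¹)
    simp only [delta, lp.single_apply, Pi.single_apply, mul_inv_eq_one]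
  have h := congrArg (fun S : EllTwo G →L[ℂ] EllTwo G => S (delta 1) x)
    (comm_permRep_mulRight hT g)
  rw [hd]
  exact h.symm

theorem inner_apply_apply {S T : EllTwo G →L[ℂ] EllTwo G} (hS : S ∈ vN G) :
    inner ℂ (delta (1 : G)) (S (T (delta 1))) =
      ∑' g : G, S (delta 1) g⁻¹ * T (delta 1) g := by
  rw [← ContinuousLinearMap.adjoint_inner_left, lp.inner_eq_tsum]
  refine tsum_congr fun g => ?_
  have h : ContinuousLinearMap.adjoint S (delta 1) g = star (S (delta 1) g⁻¹) := by
    rw [← inner_delta_left, ContinuousLinearMap.adjoint_inner_right, ← inner_conj_symm,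
      inner_delta_left, apply_delta hS, one_mul]
    rfl
  rw [h, RCLike.inner_apply]
  simp [mul_comm]

theorem vnTrace_mul_comm (S T : vN G) : vnTrace G (S * T) = vnTrace G (T * S) := by
  change inner ℂ (delta (1 : G)) (S.1 (T.1 (delta 1))) = inner ℂ (delta (1 : G)) (T.1 (S.1 (delta 1)))
  rw [inner_apply_apply S.2, inner_apply_apply T.2, ← Equiv.tsum_eq (Equiv.inv G)]
  refine tsum_congr fun g => ?_
  simp [mul_comm]

end GroupAlg

open GroupAlg

/-- The Kaplansky trace `κ : K₀(C*_r(G)) → K₀(N(G)) → ℂ`. -/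
noncomputable def kaplanskyTrace (G : Type*) [Group G] : KZero (reducedCStar G) →+ ℂ :=
  (KZero.trace (vnTrace G) vnTrace_mul_comm).comp
    (KZero.map (cstarToVN G : reducedCStar G →+* vN G))

/-- The composition `K₀(ℂG) → K₀(C*_r(G)) → K₀(N(G)) → ℂ`. -/
noncomputable def groupRingTrace (G : Type*) [Group G] : KZero (MonoidAlgebra ℂ G) →+ ℂ :=
  (kaplanskyTrace G).comp (KZero.map (groupRingToCStar G : MonoidAlgebra ℂ G →+* reducedCStar G))

/-- The multiplicative monoid of all products of orders of finite subgroups of `G`. -/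
def finiteOrderProducts (G : Type*) [Group G] : Submonoid ℕ :=
  Submonoid.closure {n | ∃ F : Subgroup G, Finite F ∧ Nat.card F = n}

theorem finiteOrderProducts_ne_zero {G : Type*} [Group G] {n : ℕ}
    (hn : n ∈ finiteOrderProducts G) : n ≠ 0 := by
  have h : finiteOrderProducts G ≤ nonZeroDivisors ℕ := by
    refine Submonoid.closure_le.2 ?_
    rintro n ⟨F, hF, rfl⟩
    exact mem_nonZeroDivisors_of_ne_zero Nat.card_pos.ne'
  exact nonZeroDivisors.ne_zero (h hn)

/-- The ring `Λ_G` of the rational numbers that can be written with a denominator that is a product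
of orders of finite subgroups of `G`. -/
def lambdaRing (G : Type*) [Group G] : Subring ℚ where
  carrier := {q | ∃ a : ℤ, ∃ d ∈ finiteOrderProducts G, q = a / d}
  one_mem' := ⟨1, 1, one_mem _, by simp⟩
  zero_mem' := ⟨0, 1, one_mem _, by simp⟩
  mul_mem' := by
    rintro _ _ ⟨a, d, hd, rfl⟩ ⟨b, e, he, rfl⟩
    refine ⟨a * b, d * e, mul_mem hd he, ?_⟩
    push_cast
    rw [div_mul_div_comm]
  add_mem' := by
    rintro _ _ ⟨a, d, hd, rfl⟩ ⟨b, e, he, rfl⟩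
    refine ⟨a * e + d * b, d * e, mul_mem hd he, ?_⟩
    have hd0 : (d : ℚ) ≠ 0 := Nat.cast_ne_zero.2 (finiteOrderProducts_ne_zero hd)
    have he0 : (e : ℚ) ≠ 0 := Nat.cast_ne_zero.2 (finiteOrderProducts_ne_zero he)
    push_cast
    rw [div_add_div _ _ hd0 he0]
  neg_mem' := by
    rintro _ ⟨a, d, hd, rfl⟩
    exact ⟨-a, d, hd, by push_cast; rw [neg_div]⟩

/-- The modified trace conjecture of Baum and Connes for the discrete group `G`: the image of the
Kaplansky trace lies in `Λ_G`. -/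
def ModifiedTraceConjecture (G : Type*) [Group G] : Prop :=
  ∀ x : KZero (reducedCStar G), ∃ q ∈ lambdaRing G, kaplanskyTrace G x = (q : ℂ)

/-- The Farkas conjecture for the discrete group `G`: if a prime `p` divides the denominator of
a rational number (in lowest terms, hence nonintegral) in the image of `K₀(ℂG) → ℂ`, then `G` has
an element of order `p`. -/
def FarkasConjecture (G : Type*) [Group G] : Prop :=
  ∀ (x : KZero (MonoidAlgebra ℂ G)) (q : ℚ), groupRingTrace G x = (q : ℂ) →
    ∀ p : ℕ, p.Prime → p ∣ q.den → ∃ g : G, orderOf g = p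

universe u

/-! Only the passage from binate groups to all groups needs proof. It rests on embedding `G` in a
binate group `A` with no new prime orders of elements, and on the invariance of traces under group
embeddings.

For the embedding (`exists_binate_embedding`), iterate the unrestricted wreath product with ℤ and
take the union. In each step the old group becomes a group of commutators `[u, φ d]`: `φ d` repeats
`d` in all positive coordinates, and shifting it by one place changes it only at the coordinate 0.
As ℤ is torsion-free, an element of prime order `p` lies in the base group and has a coordinate of
order `p`. By Cauchy's theorem the control of prime orders gives `lambdaRing A ≤ lambdaRing G`.

For the traces, `ℓ²(A)` is a sum of copies of `ℓ²(G)`, one for each right coset of `G`. Letting an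
operator act on every copy maps `reducedCStar G` to `reducedCStar A`, extends the map of group
rings, and preserves the trace. So every trace value for `G` is one for `A`
(`kaplanskyTrace_comp_map`, `groupRingTrace_comp_map`), where the conjecture applies. -/

/-! ### Unrestricted wreath products with ℤ. -/

namespace RegularWreathProduct

variable {D : Type*} [Group D]

/-- The embedding of the base group `D` in `D ≀ᵣ Q` as the coordinate at `1`. -/
def single {Q : Type*} [Group Q] [DecidableEq Q] : D →* D ≀ᵣ Q where
  toFun d := ⟨Pi.mulSingle 1 d, 1⟩
  map_one' := by ext <;> simp
  map_mul' a b := by ext <;> simp [Pi.mulSingle_mul]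

theorem single_injective {Q : Type*} [Group Q] [DecidableEq Q] :
    Function.Injective (single : D →* D ≀ᵣ Q) := fun _ _ h =>
  Pi.mulSingle_injective 1 (congrArg left h)

theorem pow_of_right_eq_one {Q : Type*} [Group Q] (f : Q → D) (n : ℕ) :
    (⟨f, 1⟩ : D ≀ᵣ Q) ^ n = ⟨f ^ n, 1⟩ := by
  induction n with
  | zero => rw [pow_zero, pow_zero]; rfl
  | succ n ih => rw [pow_succ, ih]; ext <;> simp [pow_succ]

/-- If `Q` is torsion-free, then every prime order of an element of `D ≀ᵣ Q` is the order of
an element of `D`. -/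
theorem exists_orderOf_eq {Q : Type*} [Group Q] [IsMulTorsionFree Q] {p : ℕ} (hp : p.Prime)
    {w : D ≀ᵣ Q} (hw : orderOf w = p) : ∃ d : D, orderOf d = p := by
  have : Fact p.Prime := ⟨hp⟩
  obtain ⟨f, q⟩ := w
  obtain ⟨hpow, hne⟩ := orderOf_eq_prime_iff.1 hw
  have hq : q = 1 := by
    have h : q ^ p = 1 := by
      have := congrArg rightHom hpow
      rwa [map_pow, map_one] at this
    exact (pow_eq_one_iff_left hp.ne_zero).1 h
  subst hq
  rw [pow_of_right_eq_one] at hpow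
  -- The element lies in the base group. As `p` is prime, any nontrivial coordinate has order
  -- exactly `p`.
  have hf : ∃ x, f x ≠ 1 := by
    by_contra! h
    exact hne (by ext <;> simp [h])
  obtain ⟨x, hx⟩ := hf
  exact ⟨f x, orderOf_eq_prime (congrFun (congrArg left hpow) x) hx⟩

/-- The homomorphism `D → D ≀ᵣ ℤ` which is diagonal in the positive coordinates. -/
def positiveDiagonal : D →* D ≀ᵣ Multiplicative ℤ where
  toFun d := ⟨fun n => if 0 < n.toAdd then d else 1, 1⟩
  map_one' := by ext <;> simp
  map_mul' a b := by
    ext n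
    · by_cases h : 0 < n.toAdd <;> simp [h]
    · simp

/-- Conjugation by the generator `-1` moves the support from `k > 0` to `k ≥ 0`, so the quotient of
the two diagonals lives at `k = 0` only. The supports are infinite, which is why the wreath product
must be unrestricted. -/
theorem single_eq_commutator (d : D) :
    (single d : D ≀ᵣ Multiplicative ℤ) =
      inl (Multiplicative.ofAdd (-1)) * positiveDiagonal d * (inl (Multiplicative.ofAdd (-1)))⁻¹ *
        (positiveDiagonal d)⁻¹ := by
  rw [eq_mul_inv_iff_mul_eq, eq_mul_inv_iff_mul_eq]
  ext n
  · have key : ∀ k : ℤ, (if k = 0 then d else 1) * (if 0 < k then d else 1) =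
        if 0 < 1 + k then d else 1 := by
      intro k
      rcases lt_trichotomy k 0 with h | h | h
      · rw [if_neg h.ne, if_neg h.not_gt, if_neg (by lia), one_mul]
      · simp [h]
      · rw [if_neg h.ne', if_pos h, if_pos (by lia), one_mul]
    have h := key n.toAdd
    have h1 : n.toAdd = 0 ↔ n = 1 := Iff.rfl
    simpa [single, positiveDiagonal, inl, mul_def, Pi.mulSingle_apply, h1] using h
  · simp [single, positiveDiagonal, inl]

end RegularWreathProduct

/-! ### The tower of wreath products and its binate union. -/

namespace BinateTower

open RegularWreathProduct

variable (G : Type u) [Group G]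

/-- The groups `G`, `G ≀ᵣ ℤ`, `(G ≀ᵣ ℤ) ≀ᵣ ℤ`, …. -/
def tower : ℕ → GrpCat.{u}
  | 0 => GrpCat.of G
  | n + 1 => GrpCat.of (tower n ≀ᵣ Multiplicative ℤ)

/-- The embedding of each group of the tower in the next. -/
def next (n : ℕ) : tower G n →* tower G (n + 1) :=
  (single : tower G n →* tower G n ≀ᵣ Multiplicative ℤ)

theorem next_injective (n : ℕ) : Function.Injective (next G n) :=
  single_injective (D := tower G n) (Q := Multiplicative ℤ)

theorem exists_next_eq_commutator (n : ℕ) :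
    ∃ (φ : tower G n →* tower G (n + 1)) (u : tower G (n + 1)),
      ∀ g, next G n g = u * φ g * u⁻¹ * (φ g)⁻¹ :=
  ⟨positiveDiagonal (D := tower G n), inl (Multiplicative.ofAdd (-1)),
    single_eq_commutator (D := tower G n)⟩

instance nontrivial_succ (n : ℕ) : Nontrivial (tower G (n + 1)) :=
  Function.Surjective.nontrivial (f := fun x : tower G n ≀ᵣ Multiplicative ℤ => x.right)
    fun q => ⟨inl q, rfl⟩

theorem exists_orderOf_eq_of_tower {p : ℕ} (hp : p.Prime) (n : ℕ) (x : tower G n)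
    (hx : orderOf x = p) : ∃ g : G, orderOf g = p := by
  induction n with
  | zero => exact ⟨x, hx⟩
  | succ n ih =>
    obtain ⟨d, hd⟩ := RegularWreathProduct.exists_orderOf_eq (D := tower G n)
      (Q := Multiplicative ℤ) hp hx
    exact ih d hd

/-- The transition maps of the tower. -/
def transition (i j : ℕ) (h : i ≤ j) : tower G i →* tower G j :=
  Nat.leRecOn h (fun {k} f => (next G k).comp f) (MonoidHom.id (tower G i))

/-- Reduces the transition homomorphisms to a recursion on plain functions, to which the general
facts on `Nat.leRecOn` apply. -/
theorem coe_transition (i j : ℕ) (h : i ≤ j) :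
    (transition G i j h : tower G i → tower G j) = Nat.leRecOn h (fun {k} => next G k) := by
  obtain ⟨k, rfl⟩ := Nat.exists_eq_add_of_le h
  ext x
  induction k with
  | zero => simp [transition, Nat.leRecOn_self]
  | succ k ih =>
    rw [Nat.leRecOn_succ le_self_add, transition, Nat.leRecOn_succ le_self_add, ← transition,
      MonoidHom.comp_apply, ih]

instance directedSystem : DirectedSystem (fun n => tower G n) fun i j h => transition G i j h :=
  ⟨fun _ _ => by rw [coe_transition]; exact Nat.leRecOn_self _,
   fun _ _ _ hij hjk _ => by simp only [coe_transition, Nat.leRecOn_trans hij hjk]⟩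

theorem transition_injective (i j : ℕ) (h : i ≤ j) : Function.Injective (transition G i j h) := by
  rw [coe_transition]
  exact Nat.leRecOn_injective h (fun {k} => next G k) (next_injective G)

theorem transition_succ (i : ℕ) (h : i ≤ i + 1) : transition G i (i + 1) h = next G i := by
  ext x
  rw [coe_transition]
  exact Nat.leRecOn_succ' (C := fun n => tower G n) x

/-- The union of the tower `G ≤ G ≀ᵣ ℤ ≤ (G ≀ᵣ ℤ) ≀ᵣ ℤ ≤ …`. -/
abbrev Union : Type u := DirectLimit (fun n => tower G n) (transition G)

/-- The inclusion of a group of the tower in the union. -/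
def toUnion (n : ℕ) : tower G n →* Union G where
  toFun x := ⟦⟨n, x⟩⟧
  map_one' := (DirectLimit.one_def (f := transition G) n).symm
  map_mul' x y := (DirectLimit.mul_def (f := transition G) n x y).symm

theorem toUnion_injective (n : ℕ) : Function.Injective (toUnion G n) :=
  DirectLimit.mk_injective (f := transition G) (transition_injective G) n

theorem toUnion_transition {i j : ℕ} (h : i ≤ j) (x : tower G i) :
    toUnion G j (transition G i j h x) = toUnion G i x :=
  (DirectLimit.eq_of_le (F := fun n => tower G n) (f := transition G) ⟨i, x⟩ j h).symm

theorem toUnion_next (n : ℕ) (x : tower G n) : toUnion G (n + 1) (next G n x) = toUnion G n x := by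
  rw [← transition_succ G n n.le_succ, toUnion_transition]

theorem exists_toUnion_eq (x : Union G) : ∃ n y, toUnion G n y = x := by
  obtain ⟨n, y, h⟩ := DirectLimit.exists_eq_mk (transition G) x
  exact ⟨n, y, h.symm⟩

theorem range_toUnion_mono {i j : ℕ} (h : i ≤ j) : (toUnion G i).range ≤ (toUnion G j).range := by
  rintro _ ⟨x, rfl⟩
  exact ⟨_, toUnion_transition G h x⟩

theorem exists_le_range {H : Subgroup (Union G)} (hH : H.FG) : ∃ n, H ≤ (toUnion G n).range := by
  obtain ⟨S, rfl⟩ := hH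
  choose i y hy using exists_toUnion_eq G
  refine ⟨S.sup i, (Subgroup.closure_le _).2 fun x hx => ?_⟩
  exact range_toUnion_mono G (Finset.le_sup hx) ⟨y x, hy x⟩

/-- A finitely generated subgroup lies in one level, and the next level makes that level consist of
commutators; in the union, `next` becomes an inclusion. -/
theorem isBinate_union : IsBinate (Union G) := by
  -- Level 1 is used because level 0 is `G` itself, which may be trivial.
  refine ⟨(toUnion_injective G 1).nontrivial, fun H hH => ?_⟩
  obtain ⟨n, hn⟩ := exists_le_range G hH
  obtain ⟨φ, u, h⟩ := exists_next_eq_commutator G n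
  let e := MonoidHom.ofInjective (toUnion_injective G n)
  refine ⟨(toUnion G (n + 1)).comp (φ.comp (e.symm.toMonoidHom.comp (Subgroup.inclusion hn))),
    toUnion G (n + 1) u, fun x => ?_⟩
  obtain ⟨y, hy⟩ := hn x.2
  have hxy : e.symm (Subgroup.inclusion hn x) = y := by
    rw [MulEquiv.symm_apply_eq]
    exact Subtype.ext hy.symm
  rw [← hy, ← toUnion_next, h]
  simp [hxy]

theorem exists_orderOf_eq_of_union {p : ℕ} (hp : p.Prime) (x : Union G) (hx : orderOf x = p) :
    ∃ g : G, orderOf g = p := by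
  obtain ⟨n, y, rfl⟩ := exists_toUnion_eq G x
  rw [orderOf_injective _ (toUnion_injective G n)] at hx
  exact exists_orderOf_eq_of_tower G hp n y hx

end BinateTower

/-- Every group embeds in a binate group which has elements of the same prime orders. -/
theorem exists_binate_embedding (G : Type u) [Group G] :
    ∃ (A : Type u) (_ : Group A) (ι : G →* A), Function.Injective ι ∧ IsBinate A ∧
      ∀ p : ℕ, p.Prime → (∃ a : A, orderOf a = p) → ∃ g : G, orderOf g = p :=
  ⟨BinateTower.Union G, inferInstance, BinateTower.toUnion G 0, BinateTower.toUnion_injective G 0,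
    BinateTower.isBinate_union G,
    fun _ hp ⟨a, ha⟩ => BinateTower.exists_orderOf_eq_of_union G hp a ha⟩

/-! ### Comparison of denominators. -/

/-- If every prime order of an element of `A` is the order of an element of `G`, then
the orders of the finite subgroups of `A` are products of orders of finite subgroups of `G`. -/
theorem finiteOrderProducts_le {G A : Type*} [Group G] [Group A]
    (h : ∀ p : ℕ, p.Prime → (∃ a : A, orderOf a = p) → ∃ g : G, orderOf g = p) :
    finiteOrderProducts A ≤ finiteOrderProducts G := by
  refine Submonoid.closure_le.2 ?_
  rintro _ ⟨F, hF, rfl⟩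
  -- Each prime factor of `|F|` is the order of an element of `F` by Cauchy, hence of an element of
  -- `G`, hence of a cyclic subgroup of `G`.
  rw [SetLike.mem_coe, ← Nat.prod_primeFactorsList (Nat.card_pos (α := F)).ne']
  refine Submonoid.list_prod_mem _ fun p hp => ?_
  have hp' := Nat.prime_of_mem_primeFactorsList hp
  have : Fact p.Prime := ⟨hp'⟩
  obtain ⟨x, hx⟩ := exists_prime_orderOf_dvd_card' p (Nat.dvd_of_mem_primeFactorsList hp)
  obtain ⟨g, hg⟩ := h p hp' ⟨x, by rw [Subgroup.orderOf_coe, hx]⟩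
  refine Submonoid.subset_closure ⟨Subgroup.zpowers g, ?_, by rw [Nat.card_zpowers, hg]⟩
  refine Nat.finite_of_card_ne_zero ?_
  rw [Nat.card_zpowers, hg]
  exact hp'.ne_zero

theorem lambdaRing_le {G A : Type*} [Group G] [Group A]
    (h : ∀ p : ℕ, p.Prime → (∃ a : A, orderOf a = p) → ∃ g : G, orderOf g = p) :
    lambdaRing A ≤ lambdaRing G := by
  rintro q ⟨a, d, hd, rfl⟩
  exact ⟨a, d, finiteOrderProducts_le h hd, rfl⟩

/-! ### Amplification of operators along a product decomposition. -/

namespace EllTwo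

variable {X Y Z : Type*} (σ : Y × X ≃ Z)

/-- The restriction of a square-summable function on `Z ≃ Y × X` to a slice `{y} × X`. -/
noncomputable def slice (y : Y) : EllTwo Z →ₗ[ℂ] EllTwo X where
  toFun f := ⟨fun x => f (σ (y, x)), by
    have h := lp.memℓp f
    change Memℓp (fun x => f (σ (y, x))) 2
    rw [memℓp_gen_iff (by norm_num)] at h ⊢
    exact h.comp_injective (σ.injective.comp (Prod.mk_right_injective y))⟩
  map_add' f g := rfl
  map_smul' c f := rfl

theorem slice_apply (y : Y) (f : EllTwo Z) (x : X) : slice σ y f x = f (σ (y, x)) := rfl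

variable {σ} in
theorem ext_slice {f g : EllTwo Z} (h : ∀ y, slice σ y f = slice σ y g) : f = g := by
  refine lp.ext (funext fun z => ?_)
  obtain ⟨⟨y, x⟩, rfl⟩ := σ.surjective z
  rw [← slice_apply, h, slice_apply]

/-- Pythagoras for the orthogonal decomposition into slices. It yields both that amplified functions
are square-summable and that amplification does not increase the operator norm. -/
theorem hasSum_norm_slice (f : EllTwo Z) :
    HasSum (fun y => ‖slice σ y f‖ ^ (2 : ENNReal).toReal) (‖f‖ ^ (2 : ENNReal).toReal) :=
  ((Equiv.hasSum_iff σ).2 (lp.hasSum_norm (by norm_num) f)).prod_fiberwise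
    fun y => lp.hasSum_norm (by norm_num) (slice σ y f)

/-- The operator that acts as `T` on every slice. -/
noncomputable def amplifyLinear (T : EllTwo X →L[ℂ] EllTwo X) : EllTwo Z →ₗ[ℂ] EllTwo Z where
  toFun f := ⟨fun z => T (slice σ (σ.symm z).1 f) (σ.symm z).2, by
    change Memℓp (fun z => T (slice σ (σ.symm z).1 f) (σ.symm z).2) 2
    refine memℓp_gen ((Equiv.summable_iff σ).1 ?_)
    -- Summing over each slice first leaves `‖T (slice σ y f)‖²`, which is at most `‖T‖² ‖slice σ y
    -- f‖²`.
    refine (summable_prod_of_nonneg fun _ => Real.rpow_nonneg (norm_nonneg _) _).2 ⟨fun y => ?_, ?_⟩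
    · simpa using (lp.hasSum_norm (p := 2) (by norm_num) (T (slice σ y f))).summable
    · have h : ∀ y, ∑' x, ‖T (slice σ y f) x‖ ^ (2 : ENNReal).toReal =
          ‖T (slice σ y f)‖ ^ (2 : ENNReal).toReal :=
        fun y => (lp.norm_rpow_eq_tsum (by norm_num) _).symm
      simp only [Equiv.symm_apply_apply, h]
      refine Summable.of_nonneg_of_le (fun _ => Real.rpow_nonneg (norm_nonneg _) _) (fun y => ?_)
        ((hasSum_norm_slice σ f).summable.mul_left (‖T‖ ^ (2 : ENNReal).toReal))
      rw [← Real.mul_rpow (norm_nonneg _) (norm_nonneg _)]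
      exact Real.rpow_le_rpow (norm_nonneg _) (T.le_opNorm _) (by norm_num)⟩
  map_add' f g := lp.ext (funext fun z => by
    change T (slice σ (σ.symm z).1 (f + g)) (σ.symm z).2 =
      (T (slice σ (σ.symm z).1 f) + T (slice σ (σ.symm z).1 g)) (σ.symm z).2
    rw [map_add, map_add])
  map_smul' c f := lp.ext (funext fun z => by
    change T (slice σ (σ.symm z).1 (c • f)) (σ.symm z).2 =
      (c • T (slice σ (σ.symm z).1 f)) (σ.symm z).2
    rw [map_smul, map_smul])

theorem slice_amplifyLinear (T : EllTwo X →L[ℂ] EllTwo X) (y : Y) (f : EllTwo Z) :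
    slice σ y (amplifyLinear σ T f) = T (slice σ y f) := by
  refine lp.ext (funext fun x => ?_)
  change T (slice σ (σ.symm (σ (y, x))).1 f) (σ.symm (σ (y, x))).2 = _
  rw [Equiv.symm_apply_apply]

theorem norm_amplifyLinear_le (T : EllTwo X →L[ℂ] EllTwo X) (f : EllTwo Z) :
    ‖amplifyLinear σ T f‖ ≤ ‖T‖ * ‖f‖ := by
  rw [← Real.rpow_le_rpow_iff (z := (2 : ENNReal).toReal) (norm_nonneg _) (by positivity)
    (by norm_num), Real.mul_rpow (norm_nonneg _) (norm_nonneg _)]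
  refine hasSum_le (fun y => ?_) (hasSum_norm_slice σ (amplifyLinear σ T f))
    ((hasSum_norm_slice σ f).mul_left (‖T‖ ^ (2 : ENNReal).toReal))
  rw [← Real.mul_rpow (norm_nonneg _) (norm_nonneg _), slice_amplifyLinear]
  exact Real.rpow_le_rpow (norm_nonneg _) (T.le_opNorm _) (by norm_num)

/-- The amplification `T ↦ 1 ⊗ T` from operators on `ℓ²(X)` to operators on `ℓ²(Z)`,
`Z ≃ Y × X`. -/
noncomputable def amplify : (EllTwo X →L[ℂ] EllTwo X) →ₐ[ℂ] (EllTwo Z →L[ℂ] EllTwo Z) :=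
  AlgHom.ofLinearMap
    { toFun := fun T => (amplifyLinear σ T).mkContinuous ‖T‖ (norm_amplifyLinear_le σ T)
      map_add' := fun _ _ => rfl
      map_smul' := fun _ _ => rfl }
    (ContinuousLinearMap.ext fun f => ext_slice (σ := σ) fun y => slice_amplifyLinear σ 1 y f)
    fun S T => ContinuousLinearMap.ext fun f => ext_slice (σ := σ) fun y =>
      (slice_amplifyLinear σ (S * T) y f).trans
        ((slice_amplifyLinear σ S y _).trans (congrArg S (slice_amplifyLinear σ T y f))).symm

theorem slice_amplify (T : EllTwo X →L[ℂ] EllTwo X) (y : Y) (f : EllTwo Z) :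
    slice σ y (amplify σ T f) = T (slice σ y f) :=
  slice_amplifyLinear σ T y f

theorem continuous_amplify : Continuous (amplify (X := X) σ) :=
  AddMonoidHomClass.continuous_of_bound (amplify (X := X) σ) 1 fun T => by
    rw [one_mul]
    exact LinearMap.mkContinuous_norm_le _ (norm_nonneg _) (norm_amplifyLinear_le σ T)

theorem slice_delta (y : Y) (x : X) : slice σ y (delta (σ (y, x))) = delta x := by
  classical
  refine lp.ext (funext fun x' => ?_)
  rw [slice_apply]
  simp [delta, lp.single_apply, Pi.single_apply]

end EllTwo

/-! ### Maps of reduced C*-algebras induced by group embeddings. -/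

namespace GroupAlg

open EllTwo

theorem star_leftReg {G : Type*} [Group G] (g : G) : star (leftReg G g) = leftReg G g⁻¹ := by
  change star (permRep _) = permRep (MulAction.toPermHom G G g⁻¹)
  rw [star_permRep, map_inv (MulAction.toPermHom G G)]

/-- All diagonal coefficients agree because `T` commutes with right translations, which act
transitively on the basis. -/
theorem inner_delta_delta_vN {G : Type*} [Group G] {T : EllTwo G →L[ℂ] EllTwo G} (hT : T ∈ vN G)
    (g : G) : T (delta g) g = inner ℂ (delta (1 : G)) (T (delta 1)) := by
  rw [inner_delta_left, apply_delta hT, mul_inv_cancel]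

variable {G A : Type*} [Group G] [Group A]

/-- For an injective homomorphism `ι : G → A`, the group `A` is a free left `G`-set. -/
theorem exists_coset_decomposition {ι : G →* A} (hι : Function.Injective ι) :
    ∃ σ : (A ⧸ ι.range) × G ≃ A, ∀ y g h, σ (y, g * h) = ι g * σ (y, h) := by
  have hrange : ∀ (y : A ⧸ ι.range) (g : G), (((ι g * y.out⁻¹)⁻¹ : A) : A ⧸ ι.range) = y := by
    intro y g
    rw [mul_inv_rev, inv_inv, QuotientGroup.mk_mul_of_mem _ (ι.range.inv_mem (MonoidHom.mem_range.2 ⟨g, rfl⟩))]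
    exact Quotient.out_eq' y
  -- Orbits of left multiplication by `G` are right cosets, while the quotient consists of left
  -- cosets; inversion exchanges the two, hence the inverted representative.
  refine ⟨Equiv.ofBijective (fun p => ι p.2 * p.1.out⁻¹) ⟨?_, fun a => ?_⟩, ?_⟩
  · rintro ⟨y, g⟩ ⟨y', g'⟩ h
    have hy : y = y' := by
      rw [← hrange y g, ← hrange y' g']
      exact congrArg (fun a : A => ((a⁻¹ : A) : A ⧸ ι.range)) h
    subst hy
    exact Prod.ext rfl (hι (mul_right_cancel h))
  · obtain ⟨g, hg⟩ : ((a⁻¹ : A) : A ⧸ ι.range).out⁻¹ * a⁻¹ ∈ ι.range :=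
      QuotientGroup.eq.1 (Quotient.out_eq' _)
    exact ⟨(((a⁻¹ : A) : A ⧸ ι.range), g⁻¹), by simp [hg]⟩
  · intro y g h
    change ι (g * h) * _ = ι g * (ι h * _)
    rw [map_mul, mul_assoc]

theorem groupRingToCStar_single (g : G) :
    (groupRingToCStar G (MonoidAlgebra.single g 1) : EllTwo G →L[ℂ] EllTwo G) = leftReg G g := by
  rw [groupRingToCStar, MonoidAlgebra.lift_single, one_smul]
  rfl

section Induced

variable {ι : G →* A} {Y : Type*} {σ : Y × G ≃ A}

theorem amplify_leftReg (hσ : ∀ y g h, σ (y, g * h) = ι g * σ (y, h)) (g : G) :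
    amplify σ (leftReg G g) = leftReg A (ι g) := by
  refine ContinuousLinearMap.ext fun f => ext_slice (σ := σ) fun y => ?_
  rw [slice_amplify]
  refine lp.ext (funext fun x => ?_)
  rw [leftReg_apply, slice_apply, slice_apply, leftReg_apply, hσ, map_inv]

theorem amplify_mem_reducedCStar (hσ : ∀ y g h, σ (y, g * h) = ι g * σ (y, h))
    {T : EllTwo G →L[ℂ] EllTwo G} (hT : T ∈ reducedCStar G) :
    amplify σ T ∈ reducedCStar A := by
  refine map_mem_closure (continuous_amplify σ) hT fun S hS => ?_
  -- `amplify` is given only as an algebra homomorphism, so adjoints are treated as extra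
  -- generators; they are again left translations.
  have hS' : S ∈ Algebra.adjoin ℂ (Set.range (leftReg G) ∪ star (Set.range (leftReg G))) := by
    rw [← StarAlgebra.adjoin_toSubalgebra]
    exact hS
  change S ∈ ((StarAlgebra.adjoin ℂ (Set.range (leftReg A))).toSubalgebra.comap (amplify σ))
  refine Algebra.adjoin_le ?_ hS'
  have key : ∀ g, amplify σ (leftReg G g) ∈ StarAlgebra.adjoin ℂ (Set.range (leftReg A)) := by
    intro g
    rw [amplify_leftReg hσ]
    exact StarAlgebra.subset_adjoin ℂ _ ⟨_, rfl⟩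
  rintro S (⟨g, rfl⟩ | ⟨g, hg⟩)
  · exact key g
  · rw [← star_star S, ← hg, star_leftReg]
    exact key _

/-- The homomorphism of reduced C*-algebras induced by a group embedding `ι`, in terms of
a decomposition of the target into `G`-orbits. -/
noncomputable def reducedCStarMap (hσ : ∀ y g h, σ (y, g * h) = ι g * σ (y, h)) :
    reducedCStar G →ₐ[ℂ] reducedCStar A :=
  ((amplify σ).comp (reducedCStar G).toSubalgebra.val).codRestrict (reducedCStar A).toSubalgebra
    fun T => amplify_mem_reducedCStar hσ T.2

theorem vnTrace_reducedCStarMap (hσ : ∀ y g h, σ (y, g * h) = ι g * σ (y, h))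
    (T : reducedCStar G) :
    vnTrace A (cstarToVN A (reducedCStarMap hσ T)) = vnTrace G (cstarToVN G T) := by
  change inner ℂ (delta (1 : A)) (amplify σ T.1 (delta 1)) =
    inner ℂ (delta (1 : G)) (T.1 (delta 1))
  -- The chosen representative of the trivial coset need not be 1, so the coefficient found is that
  -- of `T` at some `x`; it equals the one at 1.
  obtain ⟨⟨y, x⟩, hyx⟩ := σ.surjective 1
  rw [← hyx, inner_delta_left, ← slice_apply, slice_amplify, slice_delta,
    inner_delta_delta_vN (reducedCStar_le_vN G T.2)]

theorem reducedCStarMap_comp_groupRingToCStar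
    (hσ : ∀ y g h, σ (y, g * h) = ι g * σ (y, h)) :
    (reducedCStarMap hσ).comp (groupRingToCStar G) =
      (groupRingToCStar A).comp (MonoidAlgebra.mapDomainAlgHom ℂ ℂ ι) := by
  refine MonoidAlgebra.algHom_ext (fun g => Subtype.ext ?_) (Subsingleton.elim _ _)
  change amplify σ (groupRingToCStar G (MonoidAlgebra.single g 1)) =
    groupRingToCStar A (MonoidAlgebra.mapDomainAlgHom ℂ ℂ ι (MonoidAlgebra.single g 1))
  rw [groupRingToCStar_single, amplify_leftReg hσ, MonoidAlgebra.mapDomainAlgHom_apply,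
    MonoidAlgebra.mapDomain_single, groupRingToCStar_single]

end Induced

end GroupAlg

/-! ### Functoriality of K₀ and invariance of the traces. -/

namespace KZero

variable {R S T : Type*} [Ring R] [Ring S] [Ring T]

/-- By the universal property of the Grothendieck group, identities on K₀ can be tested on
idempotent matrices. -/
theorem addHom_ext {B : Type*} [AddCommGroup B] {f g : KZero R →+ B}
    (h : ∀ e : Idem R, f (Algebra.GrothendieckAddGroup.of (ProjClass.mk e)) =
      g (Algebra.GrothendieckAddGroup.of (ProjClass.mk e))) : f = g := by
  refine Algebra.GrothendieckAddGroup.lift.symm.injective (AddMonoidHom.ext fun c => ?_)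
  induction c using Quotient.inductionOn with | _ e
  exact h e

theorem map_of (f : R →+* S) (e : Idem R) :
    map f (Algebra.GrothendieckAddGroup.of (ProjClass.mk e)) =
      Algebra.GrothendieckAddGroup.of (ProjClass.mk (Idem.map f e)) :=
  DFunLike.congr_fun (Algebra.GrothendieckAddGroup.lift.symm_apply_apply
    ((Algebra.GrothendieckAddGroup.of (M := ProjClass S)).comp (ProjClass.map f))) (ProjClass.mk e)

theorem trace_of {B : Type*} [AddCommGroup B] (τ : R →+ B) (hτ : ∀ a b, τ (a * b) = τ (b * a))
    (e : Idem R) :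
    trace τ hτ (Algebra.GrothendieckAddGroup.of (ProjClass.mk e)) = ∑ i, τ (e.mat i i) :=
  DFunLike.congr_fun (Algebra.GrothendieckAddGroup.lift.symm_apply_apply
    (ProjClass.trace τ hτ)) (ProjClass.mk e)

theorem map_comp (g : S →+* T) (f : R →+* S) : map (g.comp f) = (map g).comp (map f) := by
  refine addHom_ext fun e => ?_
  rw [AddMonoidHom.comp_apply, map_of, map_of, map_of]
  rfl

end KZero

section Naturality

variable {G A : Type*} [Group G] [Group A] {ι : G →* A} {Y : Type*} {σ : Y × G ≃ A}

/-- On an idempotent matrix both sides are sums of diagonal traces, and these agree entry by entry.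
-/
theorem kaplanskyTrace_comp_map (hσ : ∀ y g h, σ (y, g * h) = ι g * σ (y, h)) :
    (kaplanskyTrace A).comp (KZero.map (reducedCStarMap hσ : reducedCStar G →+* reducedCStar A)) =
      kaplanskyTrace G := by
  refine KZero.addHom_ext fun e => ?_
  simp only [kaplanskyTrace, AddMonoidHom.comp_apply, KZero.map_of, KZero.trace_of]
  exact Finset.sum_congr rfl fun i _ => vnTrace_reducedCStarMap hσ (e.mat i i)

theorem groupRingTrace_comp_map (hσ : ∀ y g h, σ (y, g * h) = ι g * σ (y, h)) :
    (groupRingTrace A).comp (KZero.map (MonoidAlgebra.mapDomainAlgHom ℂ ℂ ι :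
      MonoidAlgebra ℂ G →+* MonoidAlgebra ℂ A)) = groupRingTrace G := by
  have h : ((groupRingToCStar A : MonoidAlgebra ℂ A →+* reducedCStar A)).comp
      (MonoidAlgebra.mapDomainAlgHom ℂ ℂ ι : MonoidAlgebra ℂ G →+* MonoidAlgebra ℂ A) =
      (reducedCStarMap hσ : reducedCStar G →+* reducedCStar A).comp
        (groupRingToCStar G : MonoidAlgebra ℂ G →+* reducedCStar G) :=
    (congrArg AlgHom.toRingHom (reducedCStarMap_comp_groupRingToCStar hσ)).symm
  rw [groupRingTrace, groupRingTrace, AddMonoidHom.comp_assoc, ← KZero.map_comp, h,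
    KZero.map_comp, ← AddMonoidHom.comp_assoc, kaplanskyTrace_comp_map]

end Naturality

/-! ### Descent of the conjectures along embeddings. -/

theorem ModifiedTraceConjecture.of_embedding {G A : Type*} [Group G] [Group A] {ι : G →* A}
    (hι : Function.Injective ι)
    (h : ∀ p : ℕ, p.Prime → (∃ a : A, orderOf a = p) → ∃ g : G, orderOf g = p)
    (hA : ModifiedTraceConjecture A) : ModifiedTraceConjecture G := by
  intro x
  obtain ⟨σ, hσ⟩ := exists_coset_decomposition hι
  obtain ⟨q, hq, hx⟩ :=
    hA (KZero.map (reducedCStarMap hσ : reducedCStar G →+* reducedCStar A) x)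
  refine ⟨q, lambdaRing_le h hq, ?_⟩
  rw [← hx, ← kaplanskyTrace_comp_map hσ]
  rfl

theorem FarkasConjecture.of_embedding {G A : Type*} [Group G] [Group A] {ι : G →* A}
    (hι : Function.Injective ι)
    (h : ∀ p : ℕ, p.Prime → (∃ a : A, orderOf a = p) → ∃ g : G, orderOf g = p)
    (hA : FarkasConjecture A) : FarkasConjecture G := by
  intro x q hx p hp hpq
  obtain ⟨σ, hσ⟩ := exists_coset_decomposition hι
  rw [← groupRingTrace_comp_map hσ] at hx
  -- The same rational `q` is a trace value for `A`; the element of order `p` found there is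
  -- replaced by one in `G`.
  exact h p hp (hA _ q hx p hp hpq)

theorem corollary4p5 :
    ((∀ (G : Type u) [Group G], ModifiedTraceConjecture G) ↔
      (∀ (G : Type u) [Group G], IsBinate G → ModifiedTraceConjecture G)) ∧
    ((∀ (G : Type u) [Group G], FarkasConjecture G) ↔
      (∀ (G : Type u) [Group G], IsBinate G → FarkasConjecture G)) := by
  refine ⟨⟨fun h G _ _ => h G, fun h G _ => ?_⟩, ⟨fun h G _ _ => h G, fun h G _ => ?_⟩⟩
  · obtain ⟨A, _, ι, hι, hA, hp⟩ := exists_binate_embedding G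
    exact (h A hA).of_embedding hι hp
  · obtain ⟨A, _, ι, hι, hA, hp⟩ := exists_binate_embedding G
    exact (h A hA).of_embedding hι hp
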